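/- Let $K$ be a field, $S=K[x_1,\dots,x_n]$ the standard graded polynomial ring, and $N=\bigoplus_{j\in\mathbb Z}N_j$ a finitely generated graded Cohen–Macaulay $S$-module of codimension $s$, i.e. of dimension $n-s$. Suppose that $N$ has a pure resolution of type $(d_0,d_1,\dots,d_s)$ with $d_0=0$, that is, its minimal graded free $S$-resolution is of the form $$0\to S^{\beta_s}(-d_s)\to\cdots\to S^{\beta_1}(-d_1)\to S^{\beta_0}(-d_0)\to 0$$ with $\beta_0,\dots,\beta_s\neq 0$. Let $P_N$ be the Hilbert polynomial of $N$, i.e. the polynomial with $P_N(m)=\sum_{j\le m}\dim_K N_j$ for all $m\gg 0$; the Hilbert coefficients of $N$ are the integers $e_0(N),\dots,e_{n-s}(N)$ with $$P_N(x)=\sum_{i=0}^{n-s}(-1)^i e_i(N)\binom{x+n-s-i}{n-s-i}.$$ Then these integers exist, and for $i=0,\dots,n-s$ $$e_i(N)=\beta_0\,\frac{\prod_{j=1}^s d_j}{(s+i)!}\sum_{1\le j_1\le j_2\le\cdots\le j_i\le s}\ \prod_{k=1}^i\bigl(d_{j_k}-(j_k+k-1)\bigr).$$ In particular, $$e_0(N)=\beta_0\frac{\prod_{j=1}^s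 d_j}{s!},\qquad e_1(N)=\beta_0\frac{\prod_{j=1}^s d_j}{(s+1)!}\sum_{i=1}^s(d_i-i)\quad(\text{if } n-s\ge1),$$ $$e_2(N)=\beta_0\frac{\prod_{j=1}^s d_j}{(s+2)!}\sum_{1\le i\le j\le s}(d_i-i)(d_j-j-1)\quad(\text{if } n-s\ge2).$$ -/

import Mathlib

open scoped BigOperators

noncomputable section

namespace PureHilbert

section Depth

variable (R : Type*) [CommRing R] (M : Type*) [AddCommGroup M] [Module R M]

/-- The depth of a module over a local ring: the supremum of the lengths of the `M`-regular
sequences contained in the maximal ideal. -/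
def depth [IsLocalRing R] : ℕ∞ :=
  ⨆ (rs : List R) (_ : RingTheory.Sequence.IsRegular M rs ∧
    ∀ r ∈ rs, r ∈ IsLocalRing.maximalIdeal R), (rs.length : ℕ∞)

/-- A module over a Noetherian ring is Cohen-Macaulay if for every maximal ideal `m` in its
support the localization `M_m` satisfies `depth M_m = dim M_m`. -/
def IsCohenMacaulay : Prop :=
  ∀ m : Ideal R, ∀ _ : m.IsMaximal, Nontrivial (LocalizedModule m.primeCompl M) →
    (depth (Localization.AtPrime m) (LocalizedModule m.primeCompl M) : WithBot ℕ∞) =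
      Module.supportDim (Localization.AtPrime m) (LocalizedModule m.primeCompl M)

/-- The module `M` has codimension `s` in `R`, that is, `dim M + s = dim R`. (The zero module,
whose dimension is `⊥`, has no codimension when `R` is nonzero of finite dimension.) -/
def HasCodimension (s : ℕ) : Prop :=
  Module.supportDim R M + (s : WithBot ℕ∞) = ringKrullDim R

end Depth

section Graded

variable (K : Type*) [Field K] (n : ℕ)

/-- The standard grading of `S = K[x_1, …, x_n]`, indexed by `ℤ` (zero in negative degrees). -/
def polyGrading (t : ℤ) : Submodule K (MvPolynomial (Fin n) K) :=
  if 0 ≤ t then MvPolynomial.homogeneousSubmodule (Fin n) K t.toNat else ⊥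

/-- The degree `t` part of the graded free module `S^b(-a)`, whose basis elements all have
degree `a`. -/
def freeGrading (b : ℕ) (a t : ℤ) : Submodule K (Fin b → MvPolynomial (Fin n) K) :=
  Submodule.pi Set.univ fun _ => polyGrading K n (t - a)

variable {K} {N : Type*} [AddCommGroup N] [Module K N]

/-- The `S`-module `N`, as a `K`-vector space, is the direct sum of the subspaces `𝒩 j`, `j ∈ ℤ`,
and `S_i 𝒩 j ⊆ 𝒩 (i + j)`. -/
structure IsGradedModule (n : ℕ) [Module (MvPolynomial (Fin n) K) N]
    (𝒩 : ℤ → Submodule K N) : Prop where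
  isInternal : DirectSum.IsInternal 𝒩
  smul_mem : ∀ (i j : ℤ) (f : MvPolynomial (Fin n) K) (x : N),
    f ∈ polyGrading K n i → x ∈ 𝒩 j → f • x ∈ 𝒩 (i + j)

/-- The graded module `N` has a pure resolution of type `(d 0, …, d s)` with ranks `β 0, …, β s`:
its minimal graded free resolution has the form
`0 → S^(β s)(-d s) → ⋯ → S^(β 1)(-d 1) → S^(β 0)(-d 0) → N → 0` with nonzero free modules
in the homological degrees `0, …, s`. The complex is continued to the left by zero modules, so that
exactness at `S^(β s)` says that the leftmost map is injective; values `d i` with `s < i`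
play no role. -/
def HasPureResolution (n : ℕ) [Module (MvPolynomial (Fin n) K) N] (𝒩 : ℤ → Submodule K N)
    (s : ℕ) (d : ℕ → ℤ) (β : ℕ → ℕ) : Prop :=
  (∀ i, β i ≠ 0 ↔ i ≤ s) ∧
  ∃ (ε : (Fin (β 0) → MvPolynomial (Fin n) K) →ₗ[MvPolynomial (Fin n) K] N)
    (φ : ∀ i, (Fin (β (i + 1)) → MvPolynomial (Fin n) K) →ₗ[MvPolynomial (Fin n) K]
      (Fin (β i) → MvPolynomial (Fin n) K)),
    -- exactness
    Function.Surjective ε ∧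
    Function.Exact (φ 0) ε ∧
    (∀ i, Function.Exact (φ (i + 1)) (φ i)) ∧
    -- all maps are homogeneous of degree zero
    (∀ t, ∀ v ∈ freeGrading K n (β 0) (d 0) t, ε v ∈ 𝒩 t) ∧
    (∀ i t, ∀ v ∈ freeGrading K n (β (i + 1)) (d (i + 1)) t,
      φ i v ∈ freeGrading K n (β i) (d i) t) ∧
    -- minimality: the image of each map lies in `(x_1, …, x_n)` times its target
    (∀ i v l, φ i v l ∈ MvPolynomial.idealOfVars (Fin n) K)

/-- The cumulative Hilbert function `H(N, m) = ∑_{j ≤ m} dim_K N_j`. The sum is finite if `N` is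
finitely generated. -/
def hilbertFunction (𝒩 : ℤ → Submodule K N) (m : ℤ) : ℕ :=
  ∑ᶠ (j : ℤ) (_ : j ≤ m), Module.finrank K (𝒩 j)

/-- `P` is the Hilbert polynomial of `N`: `H(N, m) = P(m)` for all `m ≫ 0`. -/
def IsHilbertPolynomial (𝒩 : ℤ → Submodule K N) (P : Polynomial ℚ) : Prop :=
  ∀ᶠ m : ℤ in Filter.atTop, (hilbertFunction 𝒩 m : ℚ) = P.eval (m : ℚ)

/-- The integers `e 0, …, e δ` are the Hilbert coefficients of the `δ`-dimensional module `N`: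
`P_N(x) = ∑_{i=0}^δ (-1)^i e_i binom(x + δ - i, δ - i)`. Here `Polynomial.preHilbertPoly ℚ k 0` is
the polynomial `binom(x + k, k) = (x + 1) ⋯ (x + k) / k!`. -/
structure IsHilbertCoefficients (n : ℕ) [Module (MvPolynomial (Fin n) K) N]
    (𝒩 : ℤ → Submodule K N) (δ : ℕ) (e : ℕ → ℤ) : Prop where
  supportDim_eq : Module.supportDim (MvPolynomial (Fin n) K) N = (δ : WithBot ℕ∞)
  isHilbertPolynomial : IsHilbertPolynomial 𝒩
    (∑ i ∈ Finset.range (δ + 1),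
      Polynomial.C ((-1 : ℚ) ^ i * (e i : ℚ)) * Polynomial.preHilbertPoly ℚ (δ - i) 0)

end Graded

/-- `∑_{1 ≤ j_1 ≤ ⋯ ≤ j_i ≤ s} ∏_{k=1}^i (d_{j_k} - (j_k + k - 1))`. The index `k : Fin i` counts
from zero, so that `k + 1` is the one-based index running over `1, …, i`. -/
def shiftedSum (s : ℕ) (d : ℕ → ℤ) (i : ℕ) : ℤ :=
  ∑ j ∈ (Fintype.piFinset fun _ : Fin i => Finset.Icc 1 s) with Monotone j,
    ∏ k : Fin i, (d (j k) - ((j k : ℤ) + ((k : ℕ) + 1 : ℤ) - 1))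

end PureHilbert

end

namespace PureHilbert

/-! ### Recursion for the shifted sums -/

/-! Counting dimensions degree by degree along the resolution gives `H(N, m) = ∑ j ≤ s, (-1)^j β_j
binom(m - d_j + n, n)` for `m ≥ max d_j`. By Vandermonde (`choose_sub_add_eq_sum`), the coefficient
of `binom(x + n - k, n - k)` in the Hilbert polynomial is `(-1)^k M_k`, where `M_k = ∑ j ≤ s, (-1)^j
β_j binom(d_j, k)` is `bettiMoment`. Since `dim N = n - s`, Noether normalization bounds `H(N, m)`
by `O(m^(n-s))`, so `M_k = 0` for `k < s`; hence `e_i = (-1)^s M_{s+i}`.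

It remains to evaluate `M_{s+i}`. Put `w_j = (-1)^j β_j` and `L(p) = ∑ j ≤ s, w_j p(d_j)`, so that
`k! M_k` is the value of `L` on the falling factorial of degree `k`. The vanishing moments say that
`L` kills all polynomials of degree `< s`; it also kills multiples of `∏ j ≤ s, (X - d_j)`. In the
Newton expansion of the falling factorial of degree `s + i` along `∏ j < r, (X - d_j)`, only `r = s`
survives (`factorial_mul_sum_choose_eq_shiftedSum`). Its coefficient satisfies the recursion of the
shifted sum, and `L` of the basis element is `(-1)^s β_0 d_1 ⋯ d_s`. No division by differences `d_i
- d_j` occurs. -/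

lemma shiftedSum_zero_right (s : ℕ) (d : ℕ → ℤ) : shiftedSum s d 0 = 1 := by
  have h : (Fintype.piFinset fun _ : Fin 0 => Finset.Icc 1 s).filter Monotone = Finset.univ := by
    ext j
    simp [Subsingleton.monotone j]
  rw [shiftedSum, h]
  simp

lemma shiftedSum_zero_succ (d : ℕ → ℤ) (i : ℕ) : shiftedSum 0 d (i + 1) = 0 := by
  rw [shiftedSum, Finset.sum_eq_zero]
  intro j hj
  simp only [Finset.mem_filter, Fintype.mem_piFinset] at hj
  have := hj.1 0
  simp at this

/-- Split by the last, hence largest, index. If it is not `s + 1`, all indices are at most `s`; if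
it is, removing it splits off the factor `d (s + 1) - (s + 1 + i)`. -/
lemma shiftedSum_succ_succ (s : ℕ) (d : ℕ → ℤ) (i : ℕ) :
    shiftedSum (s + 1) d (i + 1) =
      shiftedSum s d (i + 1) + (d (s + 1) - ((s + 1 + i : ℕ) : ℤ)) * shiftedSum (s + 1) d i := by
  rw [shiftedSum, ← Finset.sum_filter_not_add_sum_filter _ (fun j => j (Fin.last i) = s + 1)]
  congr 1
  · rw [shiftedSum]
    refine Finset.sum_congr ?_ fun _ _ => rfl
    ext j
    simp only [Finset.mem_filter, Fintype.mem_piFinset, Finset.mem_Icc]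
    constructor
    · rintro ⟨⟨h1, h2⟩, h3⟩
      refine ⟨fun a => ⟨(h1 a).1, ?_⟩, h2⟩
      have := h2 (Fin.le_last a)
      have := (h1 (Fin.last i)).2
      omega
    · rintro ⟨h1, h2⟩
      refine ⟨⟨fun a => ⟨(h1 a).1, (h1 a).2.trans (Nat.le_succ s)⟩, h2⟩, ?_⟩
      have := (h1 (Fin.last i)).2
      omega
  · rw [shiftedSum, Finset.mul_sum]
    refine Finset.sum_bij' (fun j _ => Fin.init j) (fun j _ => Fin.snoc (α := fun _ => ℕ) j (s + 1))
      ?_ ?_ ?_ ?_ ?_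
    · intro j hj
      simp only [Finset.mem_filter, Fintype.mem_piFinset] at hj ⊢
      exact ⟨fun a => hj.1.1 a.castSucc, fun a b hab => hj.1.2 (by simpa using hab)⟩
    · intro j hj
      simp only [Finset.mem_filter, Fintype.mem_piFinset, Finset.mem_Icc] at hj ⊢
      refine ⟨⟨fun a => ?_, fun a b hab => ?_⟩, by simp⟩
      · refine Fin.lastCases ?_ (fun a => ?_) a
        · simp
        · simpa using hj.1 a
      · revert hab
        refine Fin.lastCases ?_ (fun b => ?_) b
        · refine Fin.lastCases ?_ (fun a => ?_) a
          · simp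
          · simpa using fun _ => (hj.1 a).2
        · refine Fin.lastCases ?_ (fun a => ?_) a
          · intro h
            exact absurd h (by simp)
          · intro h
            simpa using hj.2 (by simpa using h)
    · intro j hj
      simp only [Finset.mem_filter] at hj
      conv_rhs => rw [← Fin.snoc_init_self j, hj.2]
    · intro j hj
      simp
    · intro j hj
      simp only [Finset.mem_filter] at hj
      rw [Fin.prod_univ_castSucc, hj.2, mul_comm]
      congr 1
      simp only [Fin.val_last]
      push_cast
      ring

lemma shiftedSum_one (s : ℕ) (d : ℕ → ℤ) :
    shiftedSum s d 1 = ∑ i ∈ Finset.Icc 1 s, (d i - (i : ℤ)) := by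
  induction s with
  | zero => simp [shiftedSum_zero_succ]
  | succ s ih =>
    rw [shiftedSum_succ_succ, ih, shiftedSum_zero_right, Finset.sum_Icc_succ_top (by omega)]
    simp

lemma shiftedSum_two (s : ℕ) (d : ℕ → ℤ) :
    shiftedSum s d 2 = ∑ i ∈ Finset.Icc 1 s, ∑ j ∈ Finset.Icc i s,
      (d i - (i : ℤ)) * (d j - (j : ℤ) - 1) := by
  -- With the larger index outside, `s` bounds only the outer sum, which makes induction on `s`
  -- possible.
  have h : ∑ i ∈ Finset.Icc 1 s, ∑ j ∈ Finset.Icc i s, (d i - (i : ℤ)) * (d j - (j : ℤ) - 1) =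
      ∑ j ∈ Finset.Icc 1 s, ∑ i ∈ Finset.Icc 1 j, (d i - (i : ℤ)) * (d j - (j : ℤ) - 1) := by
    refine Finset.sum_comm' fun i j => ?_
    simp only [Finset.mem_Icc]
    omega
  rw [h]
  clear h
  induction s with
  | zero => simp [shiftedSum_zero_succ]
  | succ s ih =>
    rw [shiftedSum_succ_succ, ih, shiftedSum_one, Finset.sum_Icc_succ_top (by omega) (f := fun j =>
      ∑ i ∈ Finset.Icc 1 j, (d i - (i : ℤ)) * (d j - (j : ℤ) - 1)), ← Finset.sum_mul, mul_comm]
    push_cast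
    ring

/-! ### Newton expansion of the falling factorials -/

/-- The coefficients of the falling factorial of degree `m` with respect to the Newton basis
`∏ j < r, (X - d j)`. -/
def newtonCoeff (d : ℕ → ℤ) : ℕ → ℕ → ℤ
  | 0, 0 => 1
  | 0, _ + 1 => 0
  | m + 1, 0 => (d 0 - m) * newtonCoeff d m 0
  | m + 1, r + 1 => newtonCoeff d m r + (d (r + 1) - m) * newtonCoeff d m (r + 1)

lemma newtonCoeff_of_lt (d : ℕ → ℤ) {m r : ℕ} (h : m < r) : newtonCoeff d m r = 0 := by
  induction m generalizing r with
  | zero => obtain ⟨r, rfl⟩ := Nat.exists_eq_succ_of_ne_zero h.ne'; rfl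
  | succ m ih =>
    obtain ⟨r, rfl⟩ := Nat.exists_eq_succ_of_ne_zero (by omega : r ≠ 0)
    rw [newtonCoeff, ih (by omega), ih (by omega)]
    ring

lemma newtonCoeff_self (d : ℕ → ℤ) (m : ℕ) : newtonCoeff d m m = 1 := by
  induction m with
  | zero => rfl
  | succ m ih => rw [newtonCoeff, ih, newtonCoeff_of_lt d (by omega)]; ring

/-- Both sides obey the same recursion in `(s, i)`. The boundary `s = 0` uses `d 0 = 0`: a falling
factorial of positive degree vanishes at `0`. -/
lemma newtonCoeff_add_eq_shiftedSum {d : ℕ → ℤ} (hd : d 0 = 0) (s i : ℕ) :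
    newtonCoeff d (s + i) s = shiftedSum s d i := by
  induction s generalizing i with
  | zero =>
    induction i with
    | zero => rw [shiftedSum_zero_right]; rfl
    | succ i ih =>
      rw [shiftedSum_zero_succ, ← add_assoc, newtonCoeff, ih]
      cases i with
      | zero => simp [hd]
      | succ i => rw [shiftedSum_zero_succ, mul_zero]
  | succ s ihs =>
    induction i with
    | zero => rw [shiftedSum_zero_right, add_zero, newtonCoeff_self]
    | succ i ih =>
      rw [shiftedSum_succ_succ, ← ih, ← ihs, ← add_assoc, newtonCoeff, add_right_comm s 1 i,
        add_assoc s i 1]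

open Polynomial in
-- To pass from `m` to `m + 1`, multiply the `r`-th term by `X - m = (X - d r) + (d r - m)`; this is
-- the recursion that defines `newtonCoeff`.
lemma descPochhammer_eq_sum_newtonCoeff (d : ℕ → ℤ) (m : ℕ) :
    descPochhammer ℤ m = ∑ r ∈ Finset.range (m + 1),
      C (newtonCoeff d m r) * ∏ j ∈ Finset.range r, (X - C (d j)) := by
  induction m with
  | zero => simp [newtonCoeff]
  | succ m ih =>
    have key : ∀ r, C (newtonCoeff d m r) * (∏ j ∈ Finset.range r, (X - C (d j))) *
        (X - (m : ℤ[X])) = C (newtonCoeff d m r) * (∏ j ∈ Finset.range (r + 1), (X - C (d j))) +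
          C ((d r - m) * newtonCoeff d m r) * (∏ j ∈ Finset.range r, (X - C (d j))) := by
      intro r
      rw [Finset.prod_range_succ]
      simp only [C_mul, C_sub, map_natCast]
      ring
    rw [descPochhammer_succ_right, ih, Finset.sum_mul, Finset.sum_congr rfl fun r _ => key r,
      Finset.sum_add_distrib, Finset.sum_range_succ' _ (m + 1)]
    simp only [newtonCoeff, C_add, add_mul, Finset.sum_add_distrib]
    rw [Finset.sum_range_succ (fun r => C ((d (r + 1) - (m : ℤ)) * newtonCoeff d m (r + 1)) * _),
      newtonCoeff_of_lt d (Nat.lt_succ_self m), mul_zero, C_0, zero_mul, add_zero,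
      add_assoc, ← Finset.sum_range_succ' (fun r => C ((d r - (m : ℤ)) * newtonCoeff d m r) *
        ∏ j ∈ Finset.range r, (X - C (d j))) m]

/-! ### Weighted power sums with vanishing low moments -/

open Polynomial in
/-- The linear functional `p ↦ ∑ j ≤ s, w j * p (d j)`. -/
noncomputable def weightedEval (s : ℕ) (d w : ℕ → ℤ) : ℤ[X] →ₗ[ℤ] ℤ :=
  ∑ j ∈ Finset.range (s + 1), w j • Polynomial.leval (d j)

open Polynomial in
lemma weightedEval_apply (s : ℕ) (d w : ℕ → ℤ) (p : ℤ[X]) :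
    weightedEval s d w p = ∑ j ∈ Finset.range (s + 1), w j * p.eval (d j) := by
  simp [weightedEval]

lemma weightedEval_descPochhammer (s : ℕ) (d w : ℕ → ℤ) (k : ℕ) :
    weightedEval s d w (descPochhammer ℤ k) =
      k.factorial * ∑ j ∈ Finset.range (s + 1), w j * Ring.choose (d j) k := by
  rw [weightedEval_apply, Finset.mul_sum]
  refine Finset.sum_congr rfl fun j _ => ?_
  have h := Ring.descPochhammer_eq_factorial_smul_choose (d j) k
  rw [← Polynomial.eval_eq_smeval, nsmul_eq_mul] at h
  rw [h]
  ring

open Polynomial in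
-- The falling factorials are monic, so those of degree `< s` span the integer polynomials of degree
-- `< s` over `ℤ`; on them the functional is `k!` times a vanishing moment.
lemma weightedEval_eq_zero_of_degree_lt {s : ℕ} {d w : ℕ → ℤ}
    (h : ∀ k < s, ∑ j ∈ Finset.range (s + 1), w j * Ring.choose (d j) k = 0)
    {p : ℤ[X]} (hp : p.degree < s) : weightedEval s d w p = 0 := by
  let S : Polynomial.Sequence ℤ :=
    ⟨fun k => descPochhammer ℤ k, fun k => by
      rw [degree_eq_natDegree (monic_descPochhammer ℤ k).ne_zero, descPochhammer_natDegree]⟩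
  have hspan := S.span_degreeLT (m := s) fun k _ => by
    change IsUnit (descPochhammer ℤ k).leadingCoeff
    rw [(monic_descPochhammer ℤ k).leadingCoeff]
    exact isUnit_one
  have hp' : p ∈ Submodule.span ℤ (S '' Set.Iio s) := by rwa [hspan, mem_degreeLT]
  refine (Submodule.span_le (p := LinearMap.ker (weightedEval s d w))).2 ?_ hp'
  rintro _ ⟨k, hk, rfl⟩
  change weightedEval s d w (descPochhammer ℤ k) = 0
  rw [weightedEval_descPochhammer, h k hk, mul_zero]

open Polynomial in
lemma degree_prod_X_sub_C (d : ℕ → ℤ) (t : Finset ℕ) :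
    (∏ j ∈ t, (X - C (d j))).degree = (t.card : WithBot ℕ) := by
  rw [degree_prod, Finset.sum_congr rfl fun j _ => degree_X_sub_C (d j)]
  simp

open Polynomial in
-- The products over `0, …, s - 1` and over `1, …, s` are both monic of degree `s`, so the
-- functional does not distinguish them. The second vanishes at `d 1, …, d s`, leaving only the node
-- `d 0 = 0`.
lemma weightedEval_prod_X_sub_C {s : ℕ} {d w : ℕ → ℤ} (hd : d 0 = 0)
    (h : ∀ k < s, ∑ j ∈ Finset.range (s + 1), w j * Ring.choose (d j) k = 0) :
    weightedEval s d w (∏ j ∈ Finset.range s, (X - C (d j))) =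
      (-1) ^ s * w 0 * ∏ j ∈ Finset.Icc 1 s, d j := by
  have h1 : weightedEval s d w (∏ j ∈ Finset.Icc 1 s, (X - C (d j))) =
      (-1) ^ s * w 0 * ∏ j ∈ Finset.Icc 1 s, d j := by
    rw [weightedEval_apply, Finset.sum_eq_single 0]
    · simp only [eval_prod, eval_sub, eval_X, eval_C, hd, zero_sub, Finset.prod_neg]
      simp
      ring
    · intro j hj hj0
      rw [eval_prod, Finset.prod_eq_zero (i := j), mul_zero]
      · simp only [Finset.mem_range, Finset.mem_Icc] at hj ⊢
        omega
      · simp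
    · simp
  rw [← h1, ← sub_eq_zero, ← map_sub]
  apply weightedEval_eq_zero_of_degree_lt h
  refine (degree_sub_lt_left ?_ ?_ ?_).trans_eq ?_
  · simp [degree_prod_X_sub_C, -eq_intCast]
  · exact (monic_prod_X_sub_C d _).ne_zero
  · rw [(monic_prod_X_sub_C d _).leadingCoeff, (monic_prod_X_sub_C d _).leadingCoeff]
  · simp [degree_prod_X_sub_C, -eq_intCast]

theorem factorial_mul_sum_choose_eq_shiftedSum {s : ℕ} {d w : ℕ → ℤ} (hd : d 0 = 0)
    (h : ∀ k < s, ∑ j ∈ Finset.range (s + 1), w j * Ring.choose (d j) k = 0) (i : ℕ) :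
    ((s + i).factorial : ℤ) * ∑ j ∈ Finset.range (s + 1), w j * Ring.choose (d j) (s + i) =
      (-1) ^ s * w 0 * (∏ j ∈ Finset.Icc 1 s, d j) * shiftedSum s d i := by
  rw [← weightedEval_descPochhammer, descPochhammer_eq_sum_newtonCoeff d, map_sum,
    Finset.sum_eq_single s]
  · rw [Polynomial.C_mul', map_smul, weightedEval_prod_X_sub_C hd h,
      newtonCoeff_add_eq_shiftedSum hd, smul_eq_mul, mul_comm]
  · intro r _ hr
    rw [Polynomial.C_mul', map_smul]
    -- For `r < s` the degree is too small; for `r > s` the product vanishes at every node `d 0, …,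
    -- d s`.
    rcases lt_or_gt_of_ne hr with hr | hr
    · rw [weightedEval_eq_zero_of_degree_lt h, smul_zero]
      rw [degree_prod_X_sub_C]
      simpa using hr
    · rw [weightedEval_apply, Finset.sum_eq_zero, smul_zero]
      intro j hj
      rw [Polynomial.eval_prod, Finset.prod_eq_zero (i := j), mul_zero]
      · simp only [Finset.mem_range] at hj ⊢
        omega
      · simp
  · intro hs
    simp at hs

/-- Vandermonde's identity for the Hilbert polynomial of a shifted polynomial ring. -/
lemma choose_sub_add_eq_sum (x d : ℤ) (n : ℕ) :
    Ring.choose (x - d + n) n = ∑ k ∈ Finset.range (n + 1),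
      (-1) ^ k * Ring.choose d k * Ring.choose (x + (n - k : ℕ)) (n - k) := by
  -- Upper negation turns the claim into Chu–Vandermonde for `d + (-x - 1)`.
  have hneg : ∀ (y : ℤ) (k : ℕ), Ring.choose (y + k) k = (-1) ^ k * Ring.choose (-y - 1) k := by
    intro y k
    rw [show -y - 1 = -(y + 1) by ring, Ring.choose_neg, Int.negOnePow_def, Units.smul_def]
    simp only [zpow_natCast, Units.val_pow_eq_pow_val, Units.val_neg, Units.val_one, smul_eq_mul]
    rw [← mul_assoc, ← mul_pow, show y + 1 + (k : ℤ) - 1 = y + k by ring]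
    simp
  rw [hneg, show -(x - d) - 1 = d + (-x - 1) by ring, Ring.add_choose_eq n (Commute.all _ _),
    Finset.Nat.sum_antidiagonal_eq_sum_range_succ
      (fun i j => Ring.choose d i * Ring.choose (-x - 1) j), Finset.mul_sum]
  refine Finset.sum_congr rfl fun k hk => ?_
  rw [hneg]
  have hk : k ≤ n := by simpa [Nat.lt_succ_iff] using hk
  obtain ⟨l, rfl⟩ := Nat.exists_eq_add_of_le hk
  rw [Nat.add_sub_cancel_left, pow_add]
  ring

/-! ### Growth of finite modules over polynomial rings -/

/-- Lying over starts a lifted chain of primes and going up extends it; the induction remembers that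
the last prime upstairs contracts to the last one downstairs. -/
lemma ringKrullDim_le_of_isIntegral_of_injective {A B : Type*} [CommRing A] [CommRing B]
    [Algebra A B] [Algebra.IsIntegral A B] (h : Function.Injective (algebraMap A B)) :
    ringKrullDim A ≤ ringKrullDim B := by
  refine iSup_le fun l => ?_
  have key : ∃ L : LTSeries (PrimeSpectrum B), L.length = l.length ∧
      L.last.asIdeal.comap (algebraMap A B) = l.last.asIdeal := by
    induction l using RelSeries.inductionOn' with
    | singleton p =>
      obtain ⟨Q, -, hQ, hQp⟩ := Ideal.exists_ideal_over_prime_of_isIntegral p.asIdeal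
        (⊥ : Ideal B) (by
          rw [← RingHom.ker_eq_comap_bot, (RingHom.injective_iff_ker_eq_bot _).1 h]
          exact bot_le)
      exact ⟨RelSeries.singleton _ ⟨Q, hQ⟩, rfl, hQp⟩
    | snoc l p hp ih =>
      obtain ⟨L, hL, hLl⟩ := ih
      obtain ⟨Q, hle, hQ, hQp⟩ := Ideal.exists_ideal_over_prime_of_isIntegral p.asIdeal
        L.last.asIdeal (by rw [hLl]; exact le_of_lt hp)
      have hlt : L.last < (⟨Q, hQ⟩ : PrimeSpectrum B) := by
        refine lt_of_le_of_ne hle fun heq => ?_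
        have h1 : L.last.asIdeal = Q := congrArg PrimeSpectrum.asIdeal heq
        rw [← h1, hLl] at hQp
        exact ne_of_lt hp (PrimeSpectrum.ext hQp)
      refine ⟨L.snoc ⟨Q, hQ⟩ hlt, ?_, ?_⟩
      · simp [hL]
      · simpa using hQp
  obtain ⟨L, hL, -⟩ := key
  rw [← hL]
  exact le_iSup (fun L : LTSeries (PrimeSpectrum B) => ((L.length : ℕ∞) : WithBot ℕ∞)) L

lemma finrank_restrictTotalDegree_le (K : Type*) [Field K] (r m : ℕ) :
    Module.finrank K (MvPolynomial.restrictTotalDegree (Fin r) K m) ≤ (m + 1) ^ r := by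
  refine (Submodule.finrank_mono
    (MvPolynomial.restrictTotalDegree_le_restrictDegree (Fin r) (R := K) m)).trans ?_
  have b := MvPolynomial.basisRestrictSupport K {n : Fin r →₀ ℕ | ∀ i, n i ≤ m}
  rw [MvPolynomial.restrictDegree, Module.finrank_eq_nat_card_basis b]
  let f : {n : Fin r →₀ ℕ | ∀ i, n i ≤ m} → (Fin r → Fin (m + 1)) :=
    fun n i => ⟨n.1 i, Nat.lt_succ_of_le (n.2 i)⟩
  have hf : Function.Injective f := fun a b hab => by
    ext i
    exact congrArg Fin.val (congrFun hab i)
  simpa using Nat.card_le_card_of_injective f hf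

/-- Noether normalization; the number `r` of variables is at most `dim A` because the extension is
integral and injective. -/
lemma exists_noether_generators (K : Type*) [Field K] (A : Type*) [CommRing A] [Nontrivial A]
    [Algebra K A] [Algebra.FiniteType K A] {δ : ℕ} (hdim : ringKrullDim A = (δ : WithBot ℕ∞)) :
    ∃ r ≤ δ, ∃ (g : MvPolynomial (Fin r) K →ₐ[K] A) (p : ℕ) (a : Fin p → A),
      ∀ x : A, ∃ b : Fin p → MvPolynomial (Fin r) K, x = ∑ k, g (b k) * a k := by
  obtain ⟨r, g, hg, hfin⟩ := exists_finite_inj_algHom_of_fg K A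
  let _ : Algebra (MvPolynomial (Fin r) K) A := g.toRingHom.toAlgebra
  have _ : Module.Finite (MvPolynomial (Fin r) K) A := hfin
  have h1 := ringKrullDim_le_of_isIntegral_of_injective (A := MvPolynomial (Fin r) K)
    (B := A) hg
  rw [MvPolynomial.ringKrullDim_of_isNoetherianRing, ringKrullDim_eq_zero_of_field, zero_add,
    hdim] at h1
  obtain ⟨p, a, ha⟩ := Module.Finite.exists_fin (R := MvPolynomial (Fin r) K) (M := A)
  refine ⟨r, by simpa using h1, g, p, a, fun x => ?_⟩
  have hx : x ∈ Submodule.span (MvPolynomial (Fin r) K) (Set.range a) := by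
    rw [ha]; trivial
  obtain ⟨b, hb⟩ := (Submodule.mem_span_range_iff_exists_fun _).1 hx
  exact ⟨b, hb.symm⟩

/-- A finite module over `K[x_1, …, x_n]` whose support has dimension `δ` is generated by finitely
many elements over a polynomial ring in at most `δ` variables, acting through a `K`-algebra map to
`K[x_1, …, x_n]`. -/
lemma exists_aeval_generators {K : Type*} [Field K] (n : ℕ) {N : Type*} [AddCommGroup N]
    [Module (MvPolynomial (Fin n) K) N] [Module.Finite (MvPolynomial (Fin n) K) N] {δ : ℕ}
    (hdim : Module.supportDim (MvPolynomial (Fin n) K) N = (δ : WithBot ℕ∞)) :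
    ∃ r ≤ δ, ∃ (η : MvPolynomial (Fin r) K →ₐ[K] MvPolynomial (Fin n) K) (q : ℕ) (u : Fin q → N),
      ∀ x : N, ∃ b : Fin q → MvPolynomial (Fin r) K, x = ∑ k, η (b k) • u k := by
  set S := MvPolynomial (Fin n) K
  have hN : Nontrivial N := by
    rw [← Module.supportDim_ne_bot_iff_nontrivial S, hdim]
    exact WithBot.coe_ne_bot
  set I := Module.annihilator S N
  have hI : I ≠ ⊤ := fun h => by
    have := Module.annihilator_eq_top_iff.1 h
    exact not_subsingleton N this
  have : Nontrivial (S ⧸ I) := Ideal.Quotient.nontrivial_iff.2 hI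
  rw [Module.supportDim_eq_ringKrullDim_quotient_annihilator] at hdim
  obtain ⟨r, hr, g, p, a, ha⟩ := exists_noether_generators K (S ⧸ I) hdim
  -- Lifting the normalizing elements from `S ⧸ I` to `S` is harmless, since `I` annihilates `N`.
  choose Y hY using fun i : Fin r => Ideal.Quotient.mk_surjective (I := I) (g (MvPolynomial.X i))
  let η : MvPolynomial (Fin r) K →ₐ[K] S := MvPolynomial.aeval Y
  have hη : ∀ b, Ideal.Quotient.mk I (η b) = g b := by
    intro b
    have : (Ideal.Quotient.mkₐ K I).comp η = g := by
      ext i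
      simp [η, hY]
    exact DFunLike.congr_fun this b
  choose A hA using fun k => Ideal.Quotient.mk_surjective (I := I) (a k)
  obtain ⟨l, v, hv⟩ := Module.Finite.exists_fin (R := S) (M := N)
  have hS : ∀ f : S, ∃ b : Fin p → MvPolynomial (Fin r) K, ∀ x : N,
      f • x = ∑ k, η (b k) • A k • x := by
    intro f
    obtain ⟨b, hb⟩ := ha (Ideal.Quotient.mk I f)
    refine ⟨b, fun x => ?_⟩
    have h0 : f - ∑ k, η (b k) * A k ∈ I := by
      rw [← Ideal.Quotient.eq, hb, map_sum]
      refine Finset.sum_congr rfl fun k _ => ?_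
      rw [map_mul, hη, hA]
    have h1 := Module.mem_annihilator.1 h0 x
    rw [sub_smul, sub_eq_zero, Finset.sum_smul] at h1
    simpa [mul_smul] using h1
  refine ⟨r, hr, η, p * l, fun k => A (finProdFinEquiv.symm k).1 • v (finProdFinEquiv.symm k).2,
    fun x => ?_⟩
  have hx : x ∈ Submodule.span S (Set.range v) := by rw [hv]; trivial
  obtain ⟨c, rfl⟩ := (Submodule.mem_span_range_iff_exists_fun _).1 hx
  choose b hb using hS
  refine ⟨fun k => b (c (finProdFinEquiv.symm k).2) (finProdFinEquiv.symm k).1, ?_⟩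
  rw [Equiv.sum_comp finProdFinEquiv.symm (fun k : Fin p × Fin l =>
    η (b (c k.2) k.1) • A k.1 • v k.2), Fintype.sum_prod_type_right]
  exact Finset.sum_congr rfl fun j _ => hb _ _

/-- The submodule of the families with values in the submodules `p i` is their product. -/
def submodulePiEquiv {R ι : Type*} [Semiring R] {M : ι → Type*} [∀ i, AddCommMonoid (M i)]
    [∀ i, Module R (M i)] (p : ∀ i, Submodule R (M i)) :
    Submodule.pi Set.univ p ≃ₗ[R] ∀ i, p i where
  toFun x i := ⟨x.1 i, x.2 i trivial⟩
  invFun x := ⟨fun i => x i, fun i _ => (x i).2⟩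
  map_add' _ _ := rfl
  map_smul' _ _ := rfl
  left_inv _ := rfl
  right_inv _ := rfl

/-- For a finite set of elements `v` of a finite module with support of dimension `δ`, the
`K`-subspace of the combinations of `v` with coefficients of degree at most `m` is contained in a
subspace whose dimension is `O(m ^ δ)`. -/
theorem exists_finrank_le_pow {K : Type*} [Field K] (n : ℕ) {N : Type*} [AddCommGroup N]
    [Module K N] [Module (MvPolynomial (Fin n) K) N] [IsScalarTower K (MvPolynomial (Fin n) K) N]
    [Module.Finite (MvPolynomial (Fin n) K) N] {δ : ℕ}
    (hdim : Module.supportDim (MvPolynomial (Fin n) K) N = (δ : WithBot ℕ∞))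
    {ι : Type*} [Finite ι] (v : ι → N) :
    ∃ C : ℕ, ∀ m : ℕ, ∃ W : Submodule K N, FiniteDimensional K W ∧
      Module.finrank K W ≤ C * (m + 1) ^ δ ∧
      ∀ (f : MvPolynomial (Fin n) K) (i : ι), f.totalDegree ≤ m → f • v i ∈ W := by
  obtain ⟨r, hr, η, q, u, hu⟩ := exists_aeval_generators n (N := N) hdim
  let Φ : (Fin q → MvPolynomial (Fin r) K) →ₗ[K] N :=
    { toFun := fun b => ∑ k, η (b k) • u k
      map_add' := fun a b => by simp [add_smul, Finset.sum_add_distrib]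
      map_smul' := fun c b => by simp [Finset.smul_sum] }
  let G : ℕ → Submodule K N := fun m =>
    (Submodule.pi Set.univ fun _ : Fin q => MvPolynomial.restrictTotalDegree (Fin r) K m).map Φ
  have hG : ∀ m (b : Fin q → MvPolynomial (Fin r) K), (∀ k, (b k).totalDegree ≤ m) →
      ∑ k, η (b k) • u k ∈ G m := fun m b hb =>
    ⟨b, fun k _ => (MvPolynomial.mem_restrictTotalDegree _ _ _).2 (hb k), rfl⟩
  have hGmono : Monotone G := fun a b hab => Submodule.map_mono <| by
    intro x hx k hk
    have := hx k hk
    rw [SetLike.mem_coe, MvPolynomial.mem_restrictTotalDegree] at this ⊢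
    exact this.trans hab
  choose b hb using hu
  have := Fintype.ofFinite ι
  -- `c` bounds the degrees of the coefficients needed to write every `X i • u k` and every `v i` in
  -- terms of the `u l`. Hence `v i ∈ G c`, and each multiplication by a variable raises the
  -- filtration `G` by at most `c`.
  let c : ℕ := (Finset.univ.sup fun ij : Fin n × Fin q × Fin q =>
      (b ((MvPolynomial.X ij.1 : MvPolynomial (Fin n) K) • u ij.2.1) ij.2.2).totalDegree) +
    Finset.univ.sup fun ij : ι × Fin q => (b (v ij.1) ij.2).totalDegree
  have hX : ∀ i m x, x ∈ G m → (MvPolynomial.X i : MvPolynomial (Fin n) K) • x ∈ G (c + m) := by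
    rintro i m _ ⟨a, ha, rfl⟩
    change (MvPolynomial.X i : MvPolynomial (Fin n) K) • ∑ k, η (a k) • u k ∈ _
    have h1 : (MvPolynomial.X i : MvPolynomial (Fin n) K) • ∑ k, η (a k) • u k =
        ∑ l, η (∑ k, a k * b ((MvPolynomial.X i : MvPolynomial (Fin n) K) • u k) l) • u l := by
      simp only [map_sum, map_mul, Finset.sum_smul, mul_smul]
      rw [Finset.sum_comm, Finset.smul_sum]
      refine Finset.sum_congr rfl fun k _ => ?_
      rw [← Finset.smul_sum, ← hb, smul_comm]
    rw [h1]
    refine hG _ _ fun l => MvPolynomial.totalDegree_finsetSum_le fun k _ => ?_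
    refine (MvPolynomial.totalDegree_mul _ _).trans ?_
    rw [add_comm]
    refine add_le_add ?_ ((MvPolynomial.mem_restrictTotalDegree _ _ _).1 (ha k trivial))
    exact (Finset.le_sup (f := fun ij : Fin n × Fin q × Fin q =>
      (b ((MvPolynomial.X ij.1 : MvPolynomial (Fin n) K) • u ij.2.1) ij.2.2).totalDegree)
      (Finset.mem_univ (i, k, l))).trans (Nat.le_add_right _ _)
  have hv : ∀ i, v i ∈ G c := by
    intro i
    rw [hb (v i)]
    refine hG _ _ fun l => ?_
    exact (Finset.le_sup (f := fun ij : ι × Fin q => (b (v ij.1) ij.2).totalDegree)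
      (Finset.mem_univ (i, l))).trans (Nat.le_add_left _ _)
  have hmon : ∀ (M : ℕ) (e : Fin n →₀ ℕ) (i : ι), e.degree = M →
      (MvPolynomial.monomial e (1 : K)) • v i ∈ G (c * (M + 1)) := by
    intro M
    induction M with
    | zero =>
      intro e i he
      rw [Finsupp.degree_eq_zero_iff] at he
      subst he
      simpa using hv i
    | succ M ih =>
      intro e i he
      have he0 : e ≠ 0 := by rintro rfl; simp at he
      obtain ⟨j, hj⟩ := Finsupp.ne_iff.1 he0
      obtain ⟨e', rfl⟩ : ∃ e', e = Finsupp.single j 1 + e' :=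
        exists_add_of_le (Finsupp.single_le_iff.2 (Nat.one_le_iff_ne_zero.2 hj))
      rw [map_add, Finsupp.degree_single] at he
      have h1 := hX j _ _ (ih e' i (by omega))
      rw [← mul_smul, MvPolynomial.X, MvPolynomial.monomial_mul, one_mul] at h1
      exact hGmono (le_of_eq (by ring)) h1
  have hfin : ∀ m, Module.Finite K (Submodule.pi Set.univ fun _ : Fin q =>
      MvPolynomial.restrictTotalDegree (Fin r) K m) := fun m =>
    Module.Finite.equiv (submodulePiEquiv _).symm
  refine ⟨q * (c + 1) ^ r, fun m => ⟨G (c * (m + 1)), ?_, ?_, ?_⟩⟩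
  · infer_instance
  · calc Module.finrank K (G (c * (m + 1)))
        ≤ Module.finrank K (Submodule.pi Set.univ fun _ : Fin q =>
            MvPolynomial.restrictTotalDegree (Fin r) K (c * (m + 1))) :=
          Submodule.finrank_map_le _ _
      _ = ∑ _k : Fin q, Module.finrank K
            (MvPolynomial.restrictTotalDegree (Fin r) K (c * (m + 1))) := by
          rw [(submodulePiEquiv _).finrank_eq, Module.finrank_pi_fintype]
      _ ≤ q * (c * (m + 1) + 1) ^ r := by
          rw [Finset.sum_const, Finset.card_univ, Fintype.card_fin, smul_eq_mul]
          exact Nat.mul_le_mul_left _ (finrank_restrictTotalDegree_le K r _)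
      _ ≤ q * ((c + 1) * (m + 1)) ^ r := by
          gcongr
          nlinarith
      _ ≤ q * (c + 1) ^ r * (m + 1) ^ δ := by
          rw [mul_pow, ← mul_assoc]
          gcongr
          omega
  · intro f i hf
    rw [f.as_sum, Finset.sum_smul]
    refine Submodule.sum_mem _ fun e he => ?_
    have h1 : MvPolynomial.monomial e (f.coeff e) = f.coeff e • MvPolynomial.monomial e (1 : K) := by
      simp [MvPolynomial.smul_monomial]
    rw [h1, smul_assoc]
    refine Submodule.smul_mem _ _ (hGmono ?_ (hmon _ e i rfl))
    gcongr
    exact (MvPolynomial.le_totalDegree he).trans hf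

/-! ### The graded pieces of free modules -/

section FreeGrading

variable (K : Type*) [Field K] (n : ℕ)

lemma polyGrading_of_neg {t : ℤ} (ht : t < 0) : polyGrading K n t = ⊥ := by
  rw [polyGrading, if_neg (by omega)]

lemma polyGrading_natCast (k : ℕ) :
    polyGrading K n k = MvPolynomial.homogeneousSubmodule (Fin n) K k := by
  rw [polyGrading, if_pos (by omega), Int.toNat_natCast]

instance polyGrading_finite (t : ℤ) : Module.Finite K (polyGrading K n t) := by
  rw [Module.Finite.iff_fg]
  rcases lt_or_ge t 0 with ht | ht
  · rw [polyGrading_of_neg K n ht]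
    exact Submodule.fg_bot
  · lift t to ℕ using ht
    rw [polyGrading_natCast]
    exact MvPolynomial.homogeneousSubmodule_fg _ _ _

lemma finrank_homogeneousSubmodule (k : ℕ) :
    Module.finrank K (MvPolynomial.homogeneousSubmodule (Fin n) K k) = n.multichoose k := by
  rw [MvPolynomial.homogeneousSubmodule_eq_finsupp_supported]
  have b := MvPolynomial.basisRestrictSupport K {e : Fin n →₀ ℕ | e.degree = k}
  rw [← MvPolynomial.restrictSupport, Module.finrank_eq_nat_card_basis b]
  have h : {e : Fin n →₀ ℕ | e.degree = k} =
      ((Finset.univ : Finset (Fin n)).finsuppAntidiag k : Set (Fin n →₀ ℕ)) := by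
    ext e
    simp [Finset.mem_finsuppAntidiag, Finsupp.degree_eq_sum]
  rw [h, Nat.card_coe_set_eq, Set.ncard_coe_finset,
    Finset.card_finsuppAntidiag_nat_eq_multichoose]
  simp

instance freeGrading_finite (b : ℕ) (a t : ℤ) : Module.Finite K (freeGrading K n b a t) :=
  Module.Finite.equiv (submodulePiEquiv _).symm

lemma finrank_freeGrading (b : ℕ) (a t : ℤ) :
    Module.finrank K (freeGrading K n b a t) = b * Module.finrank K (polyGrading K n (t - a)) := by
  rw [freeGrading, (submodulePiEquiv _).finrank_eq, Module.finrank_pi_fintype]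
  simp

/-- The hockey-stick identity; degrees below `a` contribute nothing, so any `T ≤ a` may serve as
lower limit. -/
lemma sum_finrank_polyGrading {T a m : ℤ} (hT : T ≤ a) (hm : a ≤ m) :
    ((∑ t ∈ Finset.Icc T m, Module.finrank K (polyGrading K n (t - a)) : ℕ) : ℤ) =
      Ring.choose (m - a + n) n := by
  obtain ⟨k, rfl⟩ := Int.le.dest hm
  rw [add_sub_cancel_left, ← Nat.cast_add, Ring.choose_natCast, Nat.cast_inj]
  clear hm
  induction k with
  | zero =>
    rw [Finset.sum_eq_single a]
    · rw [sub_self, ← Nat.cast_zero, polyGrading_natCast, finrank_homogeneousSubmodule]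
      simp
    · intro t ht hta
      rw [Finset.mem_Icc] at ht
      rw [polyGrading_of_neg K n (by omega)]
      simp
    · intro h
      exact absurd (Finset.mem_Icc.2 ⟨hT, by simp⟩) h
  | succ k ih =>
    have h : Finset.Icc T (a + (k + 1 : ℕ)) = insert (a + (k + 1 : ℕ)) (Finset.Icc T (a + k)) := by
      ext t
      simp only [Finset.mem_Icc, Finset.mem_insert]
      omega
    rw [h, Finset.sum_insert (by simp), ih, add_sub_cancel_left, polyGrading_natCast,
      finrank_homogeneousSubmodule, Nat.multichoose_eq, ← Nat.choose_symm_add,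
      show k + 1 + n = (n + k) + 1 by ring, ← Nat.choose_symm_of_eq_add (by ring : n + k + 1 = (k + 1) + n),
      Nat.choose_succ_succ]
    rw [show n + (k + 1) - 1 = n + k by omega, add_comm k n, add_comm]

/-- The projection of the polynomial ring onto its part of degree `t`. -/
noncomputable def polyProj (t : ℤ) : MvPolynomial (Fin n) K →ₗ[K] MvPolynomial (Fin n) K :=
  if 0 ≤ t then MvPolynomial.homogeneousComponent t.toNat else 0

variable {K n}

lemma polyProj_of_mem {t : ℤ} {p : MvPolynomial (Fin n) K} (hp : p ∈ polyGrading K n t) :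
    polyProj K n t p = p := by
  rw [polyGrading] at hp
  rw [polyProj]
  split_ifs at hp ⊢ with h
  · exact MvPolynomial.homogeneousComponent_eq_self hp
  · simpa using hp.symm

lemma polyProj_of_mem_of_ne {t t' : ℤ} (ht : t' ≠ t) {p : MvPolynomial (Fin n) K}
    (hp : p ∈ polyGrading K n t') : polyProj K n t p = 0 := by
  rw [polyGrading] at hp
  rw [polyProj]
  split_ifs with h
  · split_ifs at hp with h'
    · rw [MvPolynomial.homogeneousComponent_of_mem hp, if_neg (by omega)]
    · rw [(Submodule.mem_bot K).1 hp, map_zero]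
  · rfl

lemma exists_freeGrading_proj (b : ℕ) (a t : ℤ) :
    ∃ π : (Fin b → MvPolynomial (Fin n) K) →ₗ[K] (Fin b → MvPolynomial (Fin n) K),
      (∀ v ∈ freeGrading K n b a t, π v = v) ∧
      ∀ t' ≠ t, ∀ v ∈ freeGrading K n b a t', π v = 0 := by
  refine ⟨LinearMap.pi fun l => polyProj K n (t - a) ∘ₗ LinearMap.proj l, fun v hv => ?_,
    fun t' ht v hv => ?_⟩
  · ext1 l
    exact polyProj_of_mem (hv l trivial)
  · ext1 l
    exact polyProj_of_mem_of_ne (by omega) (hv l trivial)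

lemma iSup_freeGrading (b : ℕ) (a : ℤ) : ⨆ t, freeGrading K n b a t = ⊤ := by
  rw [eq_top_iff]
  intro v _
  rw [← Finset.univ_sum_single v]
  refine Submodule.sum_mem _ fun l _ => ?_
  rw [← MvPolynomial.sum_homogeneousComponent (v l)]
  rw [← LinearMap.coe_single (R := K), map_sum]
  refine Submodule.sum_mem _ fun k _ => ?_
  refine Submodule.mem_iSup_of_mem ((k : ℤ) + a) fun l' _ => ?_
  rw [add_sub_cancel_right, polyGrading_natCast]
  rcases eq_or_ne l' l with rfl | h
  · simpa using MvPolynomial.homogeneousComponent_isHomogeneous k (v l')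
  · simp [Pi.single_eq_of_ne h]

end FreeGrading

/-! ### Homogeneous linear maps -/

section Homogeneous

variable {K : Type*} [Field K] {A B C : Type*} [AddCommGroup A] [Module K A] [AddCommGroup B]
  [Module K B] [AddCommGroup C] [Module K C]

lemma exists_internal_proj {ℬ : ℤ → Submodule K B} (h : DirectSum.IsInternal ℬ) (t : ℤ) :
    ∃ π : B →ₗ[K] B, (∀ b ∈ ℬ t, π b = b) ∧ ∀ t' ≠ t, ∀ b ∈ ℬ t', π b = 0 := by
  let e := LinearEquiv.ofBijective (DirectSum.coeLinearMap ℬ) h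
  have he : ∀ t' (b : ℬ t'), e.symm b = DirectSum.lof K ℤ (fun i => ℬ i) t' b := by
    intro t' b
    rw [LinearEquiv.symm_apply_eq]
    exact (DirectSum.coeLinearMap_lof ℬ t' b).symm
  refine ⟨(ℬ t).subtype ∘ₗ DirectSum.component K ℤ (fun i => ℬ i) t ∘ₗ e.symm.toLinearMap,
    fun b hb => ?_, fun t' ht b hb => ?_⟩
  · have := he t ⟨b, hb⟩
    simp only [LinearMap.comp_apply, LinearEquiv.coe_coe] at this ⊢
    rw [this, DirectSum.component.lof_self]
    rfl
  · have := he t' ⟨b, hb⟩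
    simp only [LinearMap.comp_apply, LinearEquiv.coe_coe] at this ⊢
    rw [this, DirectSum.component.of, dif_neg ht]
    simp

/-- If a homogeneous element lies in the range of a homogeneous linear map, it has a homogeneous
preimage. -/
lemma mem_map_of_homogeneous {𝒜 : ℤ → Submodule K A} {ℬ : ℤ → Submodule K B}
    (hA : ⨆ t, 𝒜 t = ⊤) {t : ℤ} (hB : ∃ π : B →ₗ[K] B, (∀ b ∈ ℬ t, π b = b) ∧
      ∀ t' ≠ t, ∀ b ∈ ℬ t', π b = 0) (f : A →ₗ[K] B) (hf : ∀ t, ∀ a ∈ 𝒜 t, f a ∈ ℬ t)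
    {a : A} (ha : f a ∈ ℬ t) : f a ∈ (𝒜 t).map f := by
  obtain ⟨π, h1, h2⟩ := hB
  -- After applying the projection to degree `t`, only the degree `t` component of `a` contributes.
  rw [← h1 _ ha]
  have hmem : a ∈ ⨆ t, 𝒜 t := by rw [hA]; trivial
  clear ha
  induction hmem using Submodule.iSup_induction' with
  | mem t' x hx =>
    rcases eq_or_ne t' t with rfl | h
    · rw [h1 _ (hf _ _ hx)]
      exact ⟨x, hx, rfl⟩
    · rw [h2 _ h _ (hf _ _ hx)]
      exact zero_mem _
  | zero => simp
  | add x y _ _ hx hy => rw [map_add, map_add]; exact add_mem hx hy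

/-- Rank–nullity for `f` on `V`; the hypothesis is exactness of one graded strand. -/
lemma finrank_eq_finrank_map_add_finrank_map (g : A →ₗ[K] B) (f : B →ₗ[K] C)
    (U : Submodule K A) (V : Submodule K B) [FiniteDimensional K V]
    (h : ∀ b, b ∈ U.map g ↔ b ∈ V ∧ f b = 0) :
    Module.finrank K V = Module.finrank K (V.map f) + Module.finrank K (U.map g) := by
  rw [← LinearMap.finrank_range_add_finrank_ker (f.domRestrict V), LinearMap.range_domRestrict,
    ← Submodule.finrank_map_subtype_eq]
  have : (LinearMap.ker (f.domRestrict V)).map V.subtype = U.map g := by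
    ext b
    rw [h]
    simp [and_comm]
  rw [this]

lemma sum_finrank_le_finrank {ℬ : ℤ → Submodule K B} (h : DirectSum.IsInternal ℬ) (T : Finset ℤ)
    (W : Submodule K B) [FiniteDimensional K W] (hW : ∀ t ∈ T, ℬ t ≤ W) :
    ∑ t ∈ T, Module.finrank K (ℬ t) ≤ Module.finrank K W := by
  have hfin : ∀ t : T, Module.Finite K (ℬ t) := fun t =>
    Submodule.finiteDimensional_of_le (hW t t.2)
  choose π h1 h2 using exists_internal_proj h
  rw [← Finset.sum_coe_sort, ← Module.finrank_pi_fintype K (M := fun t : T => ℬ t)]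
  let f : (∀ t : T, ℬ t) →ₗ[K] W :=
    ∑ t : T, Submodule.inclusion (hW t t.2) ∘ₗ LinearMap.proj t
  refine LinearMap.finrank_le_finrank_of_injective (f := f) ?_
  rw [← LinearMap.ker_eq_bot, LinearMap.ker_eq_bot']
  intro x hx
  ext t
  have h3 : (∑ t : T, (x t : B)) = 0 := by
    have := congrArg W.subtype hx
    rw [LinearMap.sum_apply, map_sum, map_zero] at this
    exact this
  have h4 := congrArg (π t) h3
  rw [map_sum, map_zero, Finset.sum_eq_single t (fun t' _ ht' => h2 t t' (by
    exact fun h => ht' (Subtype.ext h)) _ (x t').2) (by simp), h1 _ _ (x t).2] at h4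
  exact h4

end Homogeneous

/-! ### Hilbert function of a module with a pure resolution -/

section Resolution

variable {K : Type*} [Field K] {n s : ℕ} {N : Type*} [AddCommGroup N] [Module K N]
  [Module (MvPolynomial (Fin n) K) N] [IsScalarTower K (MvPolynomial (Fin n) K) N]
  {𝒩 : ℤ → Submodule K N} {d : ℕ → ℤ} {β : ℕ → ℕ}

lemma exists_map_freeGrading_eq (hgraded : IsGradedModule n 𝒩)
    (hpure : HasPureResolution n 𝒩 s d β) :
    ∃ ε : (Fin (β 0) → MvPolynomial (Fin n) K) →ₗ[MvPolynomial (Fin n) K] N,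
      ∀ t, (freeGrading K n (β 0) (d 0) t).map (ε.restrictScalars K) = 𝒩 t := by
  obtain ⟨-, ε, φ, hε, -, -, hεgr, -, -⟩ := hpure
  refine ⟨ε, fun t => le_antisymm ?_ fun x hx => ?_⟩
  · rintro _ ⟨v, hv, rfl⟩
    exact hεgr t v hv
  · obtain ⟨v, rfl⟩ := hε x
    exact mem_map_of_homogeneous (iSup_freeGrading _ _)
      (exists_internal_proj hgraded.isInternal t) (ε.restrictScalars K) hεgr hx

lemma finrank_eq_alternating_sum (hgraded : IsGradedModule n 𝒩)
    (hpure : HasPureResolution n 𝒩 s d β) (t : ℤ) :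
    (Module.finrank K (𝒩 t) : ℤ) = ∑ i ∈ Finset.range (s + 1),
      (-1) ^ i * (β i : ℤ) * (Module.finrank K (polyGrading K n (t - d i)) : ℤ) := by
  obtain ⟨hβ, ε, φ, hε, hex0, hex, hεgr, hφgr, -⟩ := hpure
  let F : ∀ i, Submodule K (Fin (β i) → MvPolynomial (Fin n) K) := fun i =>
    freeGrading K n (β i) (d i) t
  -- The dimensions of the boundaries in degree `t`; they telescope in the alternating sum, and `Z s
  -- = 0` because `β (s + 1) = 0`.
  let Z : ℕ → ℤ := fun i => Module.finrank K ((F (i + 1)).map ((φ i).restrictScalars K))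
  have hF : ∀ i, (Module.finrank K (F i) : ℤ) =
      (β i : ℤ) * (Module.finrank K (polyGrading K n (t - d i)) : ℤ) := fun i => by
    rw [finrank_freeGrading, Nat.cast_mul]
  have hmem : ∀ i v, v ∈ (F (i + 1)).map ((φ i).restrictScalars K) ↔
      v ∈ F i ∧ v ∈ LinearMap.range (φ i) := by
    intro i v
    constructor
    · rintro ⟨w, hw, rfl⟩
      exact ⟨hφgr i t w hw, w, rfl⟩
    · rintro ⟨h, w, rfl⟩
      exact mem_map_of_homogeneous (iSup_freeGrading _ _) (exists_freeGrading_proj _ _ t)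
        ((φ i).restrictScalars K) (hφgr i) h
  have hmap : (F 0).map (ε.restrictScalars K) = 𝒩 t := by
    refine le_antisymm ?_ fun x hx => ?_
    · rintro _ ⟨v, hv, rfl⟩
      exact hεgr t v hv
    · obtain ⟨v, rfl⟩ := hε x
      exact mem_map_of_homogeneous (iSup_freeGrading _ _)
        (exists_internal_proj hgraded.isInternal t) (ε.restrictScalars K) hεgr hx
  have h0 : (Module.finrank K (F 0) : ℤ) = Module.finrank K (𝒩 t) + Z 0 := by
    rw [finrank_eq_finrank_map_add_finrank_map ((φ 0).restrictScalars K) (ε.restrictScalars K)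
      (F 1) (F 0) fun v => (hmem 0 v).trans (and_congr_right fun _ => (hex0 v).symm), Nat.cast_add,
      hmap]
  have hsucc : ∀ i, (Module.finrank K (F (i + 1)) : ℤ) = Z i + Z (i + 1) := fun i => by
    rw [finrank_eq_finrank_map_add_finrank_map ((φ (i + 1)).restrictScalars K)
      ((φ i).restrictScalars K) (F (i + 2)) (F (i + 1)) fun v =>
        (hmem (i + 1) v).trans (and_congr_right fun _ => (hex i v).symm), Nat.cast_add]
  have hsum : ∀ k, (Module.finrank K (𝒩 t) : ℤ) =
      ∑ i ∈ Finset.range (k + 1), (-1) ^ i * (Module.finrank K (F i) : ℤ) +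
        (-1) ^ (k + 1) * Z k := by
    intro k
    induction k with
    | zero => rw [Finset.sum_range_one, h0]; ring
    | succ k ih => rw [Finset.sum_range_succ, ih, hsucc k]; ring
  have hZ : Z s = 0 := by
    have hb : β (s + 1) = 0 := by
      by_contra h
      have := (hβ (s + 1)).1 h
      omega
    have hle := Submodule.finrank_map_le ((φ s).restrictScalars K) (F (s + 1))
    have h0 : Module.finrank K (F (s + 1)) = 0 := by rw [finrank_freeGrading, hb, zero_mul]
    rw [h0, Nat.le_zero] at hle
    exact congrArg Nat.cast hle
  rw [hsum s, hZ, mul_zero, add_zero]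
  exact Finset.sum_congr rfl fun i _ => by rw [hF, mul_assoc]

lemma grading_of_neg (hgraded : IsGradedModule n 𝒩) (hd0 : d 0 = 0)
    (hpure : HasPureResolution n 𝒩 s d β) {t : ℤ} (ht : t < 0) : 𝒩 t = ⊥ := by
  obtain ⟨ε, hε⟩ := exists_map_freeGrading_eq hgraded hpure
  rw [← hε t, eq_bot_iff]
  rintro _ ⟨v, hv, rfl⟩
  have : v = 0 := by
    ext1 l
    have := hv l trivial
    rw [hd0, sub_zero, SetLike.mem_coe, polyGrading_of_neg K n ht] at this
    exact this
  simp [this]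

lemma hilbertFunction_eq_sum_Icc (hgraded : IsGradedModule n 𝒩) (hd0 : d 0 = 0)
    (hpure : HasPureResolution n 𝒩 s d β) {T : ℤ} (hT : T ≤ 0) (m : ℤ) :
    hilbertFunction 𝒩 m = ∑ t ∈ Finset.Icc T m, Module.finrank K (𝒩 t) := by
  refine finsum_mem_eq_sum_of_inter_support_eq _ (s := {j | j ≤ m}) ?_
  ext t
  simp only [Set.mem_inter_iff, Set.mem_ofPred_eq, Function.mem_support, Finset.coe_Icc,
    Set.mem_Icc]
  refine and_congr_left fun h => ⟨fun h' => ⟨?_, h'⟩, fun h' => h'.2⟩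
  by_contra hlt
  refine h ?_
  rw [grading_of_neg hgraded hd0 hpure (by omega)]
  simp

/-- The Hilbert function of a module with a pure resolution. -/
theorem hilbertFunction_eq_alternating_sum (hgraded : IsGradedModule n 𝒩) (hd0 : d 0 = 0)
    (hpure : HasPureResolution n 𝒩 s d β) {m : ℤ} (hm : ∀ i ≤ s, d i ≤ m) :
    (hilbertFunction 𝒩 m : ℤ) = ∑ i ∈ Finset.range (s + 1),
      (-1) ^ i * (β i : ℤ) * Ring.choose (m - d i + n) n := by
  obtain ⟨T, hT⟩ : ∃ T, ∀ i ∈ Finset.range (s + 1), T ≤ d i := by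
    obtain ⟨T, hT⟩ := ((Finset.range (s + 1)).image d).bddBelow
    exact ⟨T, fun i hi => hT (Finset.mem_coe.2 (Finset.mem_image_of_mem d hi))⟩
  rw [hilbertFunction_eq_sum_Icc hgraded hd0 hpure (hd0 ▸ hT 0 (by simp)), Nat.cast_sum,
    Finset.sum_congr rfl fun t _ => finrank_eq_alternating_sum hgraded hpure t, Finset.sum_comm]
  refine Finset.sum_congr rfl fun i hi => ?_
  rw [← Finset.mul_sum, ← sum_finrank_polyGrading K n (hT i hi)
    (hm i (by simpa [Nat.lt_succ_iff] using hi)), Nat.cast_sum]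

/-- The Hilbert function of a module whose support has dimension `δ` is `O(m ^ δ)`. -/
theorem exists_hilbertFunction_le_pow [Module.Finite (MvPolynomial (Fin n) K) N]
    (hgraded : IsGradedModule n 𝒩) (hd0 : d 0 = 0)
    (hpure : HasPureResolution n 𝒩 s d β) {δ : ℕ}
    (hdim : Module.supportDim (MvPolynomial (Fin n) K) N = (δ : WithBot ℕ∞)) :
    ∃ C : ℕ, ∀ m : ℕ, hilbertFunction 𝒩 m ≤ C * (m + 1) ^ δ := by
  obtain ⟨ε, hε⟩ := exists_map_freeGrading_eq hgraded hpure
  -- The generators `ε (e_l)` all have degree `d 0 = 0`, so elements of degree at most `m` are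
  -- combinations with coefficients of degree at most `m`.
  obtain ⟨C, hC⟩ := exists_finrank_le_pow n hdim
    (fun l : Fin (β 0) => ε (Pi.single l 1))
  refine ⟨C, fun m => ?_⟩
  obtain ⟨W, hW, hWC, hWm⟩ := hC m
  rw [hilbertFunction_eq_sum_Icc hgraded hd0 hpure le_rfl]
  refine (sum_finrank_le_finrank hgraded.isInternal _ W fun t ht => ?_).trans hWC
  rw [Finset.mem_Icc] at ht
  obtain ⟨k, rfl⟩ := Int.eq_ofNat_of_zero_le ht.1
  rw [← hε]
  rintro _ ⟨v, hv, rfl⟩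
  have hv' : v = ∑ l, v l • (Pi.single l 1 : Fin (β 0) → MvPolynomial (Fin n) K) := by
    simpa using (pi_eq_sum_univ' v)
  change ε v ∈ W
  rw [hv', map_sum]
  refine Submodule.sum_mem _ fun l _ => ?_
  rw [map_smul]
  refine hWm _ _ ?_
  have h := hv l trivial
  rw [hd0, sub_zero, SetLike.mem_coe, polyGrading_natCast] at h
  exact (MvPolynomial.IsHomogeneous.totalDegree_le h).trans (by exact_mod_cast ht.2)

end Resolution

/-! ### Polynomials in the basis of the Hilbert polynomials of polynomial rings -/

lemma preHilbertPoly_eval_natCast (k m : ℕ) :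
    (Polynomial.preHilbertPoly ℚ k 0).eval (m : ℚ) =
      ((Ring.choose ((m : ℤ) + k) k : ℤ) : ℚ) := by
  rw [Polynomial.preHilbertPoly_eq_choose_sub_add ℚ k (Nat.zero_le m), ← Nat.cast_add,
    Ring.choose_natCast]
  simp

lemma degree_preHilbertPoly (k : ℕ) :
    (Polynomial.preHilbertPoly ℚ k 0).degree = k := by
  rw [Polynomial.degree_eq_natDegree, Polynomial.natDegree_preHilbertPoly]
  rw [← Polynomial.leadingCoeff_ne_zero, Polynomial.leadingCoeff_preHilbertPoly]
  positivity

open Polynomial in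
-- The `k`-th basis polynomial has degree exactly `k`, so descending from `k = n` the coefficient of
-- `X ^ k` isolates `a k`.
lemma coeff_eq_zero_of_degree_sum_preHilbertPoly_lt {n D : ℕ} {a : ℕ → ℚ}
    (h : (∑ k ∈ Finset.range (n + 1), C (a k) * preHilbertPoly ℚ k 0).degree < D) {k : ℕ}
    (hD : D ≤ k) (hk : k ≤ n) : a k = 0 := by
  induction hl : n - k using Nat.strong_induction_on generalizing k with
  | _ l ih =>
    have h1 := coeff_eq_zero_of_degree_lt (h.trans_le (Nat.cast_le.2 hD))
    rw [finsetSum_coeff, Finset.sum_eq_single k, coeff_C_mul, coeff_preHilbertPoly_self] at h1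
    · simpa [Nat.factorial_ne_zero] using h1
    · intro j hj hjk
      rw [coeff_C_mul]
      rcases lt_or_gt_of_ne hjk with hlt | hgt
      · rw [coeff_eq_zero_of_degree_lt, mul_zero]
        rw [degree_preHilbertPoly]
        exact_mod_cast hlt
      · have hjn : j ≤ n := by simpa [Nat.lt_succ_iff] using hj
        rw [ih (n - j) (by omega) (by omega) hjn rfl, zero_mul]
    · intro hk'
      exact absurd (Finset.mem_range.2 (by omega)) hk'

open Polynomial in
lemma coeff_eq_of_sum_preHilbertPoly_eq {n : ℕ} {a b : ℕ → ℚ}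
    (h : ∑ k ∈ Finset.range (n + 1), C (a k) * preHilbertPoly ℚ k 0 =
      ∑ k ∈ Finset.range (n + 1), C (b k) * preHilbertPoly ℚ k 0) {k : ℕ} (hk : k ≤ n) :
    a k = b k := by
  rw [← sub_eq_zero]
  refine coeff_eq_zero_of_degree_sum_preHilbertPoly_lt (a := fun k => a k - b k) (D := 0) ?_
    (Nat.zero_le k) hk
  simp only [C_sub, sub_mul, Finset.sum_sub_distrib]
  rw [h, sub_self, degree_zero]
  exact WithBot.bot_lt_coe _

open Polynomial in
-- Otherwise `|p / (X + 1) ^ δ|` would tend to infinity and exceed `C`.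
lemma degree_le_of_eventually_eval_le {p : ℚ[X]} {C δ : ℕ} (m₀ : ℕ)
    (h : ∀ m : ℕ, m₀ ≤ m → |p.eval (m : ℚ)| ≤ C * ((m : ℚ) + 1) ^ δ) : p.degree ≤ δ := by
  by_contra! hlt
  have hq : (((X : ℚ[X]) + 1) ^ δ).degree = δ := by
    rw [degree_pow, ← C_1, degree_X_add_C]; simp
  have h1 := abs_div_tendsto_atTop_atTop_of_degree_gt p (((X : ℚ[X]) + 1) ^ δ) (by rwa [hq])
    (by rw [← degree_ne_bot, hq]; exact WithBot.coe_ne_bot)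
  have h2 := (h1.comp tendsto_natCast_atTop_atTop).eventually_gt_atTop (C : ℚ)
  obtain ⟨m, hm1, hm2⟩ := (h2.and (Filter.eventually_ge_atTop m₀)).exists
  have h3 := h m hm2
  simp only [Function.comp_apply, eval_pow, eval_add, eval_X, eval_one, abs_div] at hm1
  rw [lt_div_iff₀ (by positivity), abs_of_nonneg (by positivity : (0 : ℚ) ≤ ((m : ℚ) + 1) ^ δ)]
    at hm1
  linarith

open Polynomial in
lemma isHilbertPolynomial_unique {K N : Type*} [Field K] [AddCommGroup N] [Module K N]
    {𝒩 : ℤ → Submodule K N} {P Q : ℚ[X]} (hP : IsHilbertPolynomial 𝒩 P)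
    (hQ : IsHilbertPolynomial 𝒩 Q) : P = Q := by
  obtain ⟨m₀, h⟩ := Filter.eventually_atTop.1 (hP.and hQ)
  refine eq_of_infinite_eval_eq P Q (Set.infinite_of_injective_forall_mem
    (f := fun m : ℕ => (m : ℚ) + (m₀.toNat : ℚ)) (fun a b hab => by simpa using hab) fun m => ?_)
  have := h (m + m₀.toNat) (by omega)
  have h2 := this.1.symm.trans this.2
  push_cast at h2
  exact h2

/-! ### Hilbert coefficients as alternating binomial moments -/

section Main

variable {K : Type*} [Field K] {n s : ℕ} {N : Type*} [AddCommGroup N]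
  [Module (MvPolynomial (Fin n) K) N] {d : ℕ → ℤ} {β : ℕ → ℕ}

lemma supportDim_eq_of_hasCodimension [Nontrivial N]
    (hcodim : HasCodimension (MvPolynomial (Fin n) K) N s) :
    s ≤ n ∧ Module.supportDim (MvPolynomial (Fin n) K) N = ((n - s : ℕ) : WithBot ℕ∞) := by
  rw [HasCodimension, MvPolynomial.ringKrullDim_of_isNoetherianRing,
    ringKrullDim_eq_zero_of_field, zero_add, Nat.card_fin] at hcodim
  have hbot := (Module.supportDim_ne_bot_iff_nontrivial (MvPolynomial (Fin n) K) N).2 inferInstance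
  generalize Module.supportDim (MvPolynomial (Fin n) K) N = x at hcodim hbot
  induction x with
  | bot => exact absurd rfl hbot
  | coe x =>
    induction x with
    | top => exact absurd hcodim (by
        rw [← WithBot.coe_natCast, ← WithBot.coe_natCast, ← WithBot.coe_add, top_add]
        exact fun h => ENat.top_ne_natCast n (WithBot.coe_injective h))
    | coe x =>
      have h : x + s = n := by exact_mod_cast hcodim
      exact ⟨by omega, by rw [← h, Nat.add_sub_cancel]; rfl⟩

/-- The alternating binomial moments `∑ j ≤ s, (-1) ^ j * β j * binom (d j) k`. -/
noncomputable def bettiMoment (s : ℕ) (d : ℕ → ℤ) (β : ℕ → ℕ) (k : ℕ) : ℤ :=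
  ∑ j ∈ Finset.range (s + 1), (-1) ^ j * (β j : ℤ) * Ring.choose (d j) k

lemma sum_preHilbertPoly_reflect (δ : ℕ) (e : ℕ → ℤ) :
    ∑ i ∈ Finset.range (δ + 1),
      Polynomial.C ((-1 : ℚ) ^ i * (e i : ℚ)) * Polynomial.preHilbertPoly ℚ (δ - i) 0 =
    ∑ k ∈ Finset.range (δ + 1),
      Polynomial.C ((-1 : ℚ) ^ (δ - k) * (e (δ - k) : ℚ)) * Polynomial.preHilbertPoly ℚ k 0 := by
  rw [← Finset.sum_range_reflect]
  refine Finset.sum_congr rfl fun j hj => ?_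
  have hj : j ≤ δ := by simpa [Nat.lt_succ_iff] using hj
  rw [Nat.add_sub_cancel, show δ - (δ - j) = j by omega]

variable [Module K N] {𝒩 : ℤ → Submodule K N}

lemma IsHilbertCoefficients.unique {δ : ℕ} {e e' : ℕ → ℤ} (he : IsHilbertCoefficients n 𝒩 δ e)
    (he' : IsHilbertCoefficients n 𝒩 δ e') {i : ℕ} (hi : i ≤ δ) : e i = e' i := by
  have h := isHilbertPolynomial_unique he.isHilbertPolynomial he'.isHilbertPolynomial
  rw [sum_preHilbertPoly_reflect, sum_preHilbertPoly_reflect] at h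
  have h2 := coeff_eq_of_sum_preHilbertPoly_eq h (Nat.sub_le δ i)
  rw [show δ - (δ - i) = i by omega] at h2
  simpa using h2

variable [IsScalarTower K (MvPolynomial (Fin n) K) N]

open Polynomial in
lemma isHilbertPolynomial_bettiMoment (hgraded : IsGradedModule n 𝒩) (hd0 : d 0 = 0)
    (hpure : HasPureResolution n 𝒩 s d β) :
    IsHilbertPolynomial 𝒩 (∑ k ∈ Finset.range (n + 1),
      C ((-1 : ℚ) ^ (n - k) * (bettiMoment s d β (n - k) : ℚ)) * preHilbertPoly ℚ k 0) := by
  obtain ⟨M, hM⟩ := ((Finset.range (s + 1)).image d).bddAbove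
  filter_upwards [Filter.eventually_ge_atTop M, Filter.eventually_ge_atTop 0] with m hmM hm0
  lift m to ℕ using hm0
  have h := hilbertFunction_eq_alternating_sum hgraded hd0 hpure (m := m) fun i hi =>
    (hM (Finset.mem_coe.2 (Finset.mem_image_of_mem d
      (Finset.mem_range.2 (Nat.lt_succ_of_le hi))))).trans hmM
  have h2 : (hilbertFunction 𝒩 m : ℤ) = ∑ k ∈ Finset.range (n + 1),
      (-1) ^ k * bettiMoment s d β k * Ring.choose ((m : ℤ) + (n - k : ℕ)) (n - k) := by
    rw [h]
    simp only [choose_sub_add_eq_sum, bettiMoment, Finset.mul_sum, Finset.sum_mul]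
    rw [Finset.sum_comm]
    refine Finset.sum_congr rfl fun k _ => Finset.sum_congr rfl fun j _ => ?_
    ring
  have h3 : (hilbertFunction 𝒩 m : ℚ) = ((hilbertFunction 𝒩 m : ℤ) : ℚ) := by simp
  rw [h3, h2, ← Finset.sum_range_reflect, eval_finsetSum, Int.cast_sum]
  refine Finset.sum_congr rfl fun k hk => ?_
  have hk : k ≤ n := by simpa [Nat.lt_succ_iff] using hk
  rw [show n + 1 - 1 - k = n - k by omega, show n - (n - k) = k by omega, eval_mul, eval_C,
    Int.cast_natCast, preHilbertPoly_eval_natCast]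
  push_cast
  ring

/-- Up to sign, this moment is the coefficient of a basis polynomial of degree `n - k > n - s`,
whereas the growth bound limits the degree of the Hilbert polynomial to `n - s`. -/
lemma bettiMoment_eq_zero [Module.Finite (MvPolynomial (Fin n) K) N]
    (hgraded : IsGradedModule n 𝒩) (hd0 : d 0 = 0)
    (hpure : HasPureResolution n 𝒩 s d β) (hs : s ≤ n)
    (hdim : Module.supportDim (MvPolynomial (Fin n) K) N = ((n - s : ℕ) : WithBot ℕ∞))
    {k : ℕ} (hk : k < s) : bettiMoment s d β k = 0 := by
  obtain ⟨C, hC⟩ := exists_hilbertFunction_le_pow hgraded hd0 hpure hdim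
  have hP := isHilbertPolynomial_bettiMoment hgraded hd0 hpure
  obtain ⟨m₀, hm₀⟩ := Filter.eventually_atTop.1 hP
  have hdeg := degree_le_of_eventually_eval_le (C := C) (δ := n - s) m₀.toNat fun m hm => by
    have h := hm₀ m (by omega)
    rw [Int.cast_natCast] at h
    rw [← h, Nat.abs_cast]
    exact_mod_cast hC m
  have h := coeff_eq_zero_of_degree_sum_preHilbertPoly_lt (k := n - k)
    (hdeg.trans_lt (Nat.cast_lt.2 (Nat.lt_succ_self _))) (by omega) (by omega)
  rw [show n - (n - k) = k by omega] at h
  simpa using h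

lemma isHilbertCoefficients_bettiMoment [Module.Finite (MvPolynomial (Fin n) K) N]
    (hgraded : IsGradedModule n 𝒩) (hd0 : d 0 = 0)
    (hpure : HasPureResolution n 𝒩 s d β) (hs : s ≤ n)
    (hdim : Module.supportDim (MvPolynomial (Fin n) K) N = ((n - s : ℕ) : WithBot ℕ∞)) :
    IsHilbertCoefficients n 𝒩 (n - s) fun i => (-1) ^ s * bettiMoment s d β (s + i) := by
  refine ⟨hdim, ?_⟩
  convert isHilbertPolynomial_bettiMoment hgraded hd0 hpure using 1
  -- The top `s` terms carry the moments of index `< s` and vanish. In the others, `(-1) ^ (s + i)`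
  -- splits into the sign `(-1) ^ i` of the definition and the `(-1) ^ s` absorbed into `e i`.
  have hsplit : n + 1 = (n - s + 1) + s := by omega
  rw [hsplit, Finset.sum_range_add _ (n - s + 1) s, sum_preHilbertPoly_reflect,
    Finset.sum_eq_zero (s := Finset.range s), add_zero]
  · refine Finset.sum_congr rfl fun k hk => ?_
    have hk : k ≤ n - s := by simpa [Nat.lt_succ_iff] using hk
    rw [show n - k = s + (n - s - k) by omega, pow_add]
    push_cast
    congr 2
    ring
  · intro k hk
    have hk : k < s := by simpa using hk
    rw [bettiMoment_eq_zero hgraded hd0 hpure hs hdim (by omega)]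
    simp

end Main

end PureHilbert

theorem theorem1p1 {K : Type*} [Field K] (n s : ℕ) {N : Type*} [AddCommGroup N] [Module K N]
    [Module (MvPolynomial (Fin n) K) N] [IsScalarTower K (MvPolynomial (Fin n) K) N]
    [Module.Finite (MvPolynomial (Fin n) K) N]
    (𝒩 : ℤ → Submodule K N) (hgraded : PureHilbert.IsGradedModule n 𝒩)
    (hCM : PureHilbert.IsCohenMacaulay (MvPolynomial (Fin n) K) N)
    (hcodim : PureHilbert.HasCodimension (MvPolynomial (Fin n) K) N s)
    (d : ℕ → ℤ) (β : ℕ → ℕ) (hd0 : d 0 = 0)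
    (hpure : PureHilbert.HasPureResolution n 𝒩 s d β) :
    s ≤ n ∧
    (∃ e : ℕ → ℤ, PureHilbert.IsHilbertCoefficients n 𝒩 (n - s) e) ∧
    ∀ e : ℕ → ℤ, PureHilbert.IsHilbertCoefficients n 𝒩 (n - s) e →
      (∀ i ≤ n - s, (e i : ℚ) =
        (β 0 : ℚ) * (((∏ j ∈ Finset.Icc 1 s, d j : ℤ) : ℚ) / ((s + i).factorial : ℚ)) *
          (PureHilbert.shiftedSum s d i : ℚ)) ∧
      (e 0 : ℚ) =
        (β 0 : ℚ) * (((∏ j ∈ Finset.Icc 1 s, d j : ℤ) : ℚ) / (s.factorial : ℚ)) ∧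
      (1 ≤ n - s → (e 1 : ℚ) =
        (β 0 : ℚ) * (((∏ j ∈ Finset.Icc 1 s, d j : ℤ) : ℚ) / ((s + 1).factorial : ℚ)) *
          ((∑ i ∈ Finset.Icc 1 s, (d i - (i : ℤ)) : ℤ) : ℚ)) ∧
      (2 ≤ n - s → (e 2 : ℚ) =
        (β 0 : ℚ) * (((∏ j ∈ Finset.Icc 1 s, d j : ℤ) : ℚ) / ((s + 2).factorial : ℚ)) *
          ((∑ i ∈ Finset.Icc 1 s, ∑ j ∈ Finset.Icc i s,
            (d i - (i : ℤ)) * (d j - (j : ℤ) - 1) : ℤ) : ℚ)) := by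

  have hN : Nontrivial N := by
    by_contra hN
    rw [not_nontrivial_iff_subsingleton] at hN
    rw [PureHilbert.HasCodimension, Module.supportDim_eq_bot_of_subsingleton, WithBot.bot_add,
      MvPolynomial.ringKrullDim_of_isNoetherianRing, ringKrullDim_eq_zero_of_field, zero_add]
      at hcodim
    exact WithBot.bot_ne_coe hcodim
  obtain ⟨hs, hdim⟩ := PureHilbert.supportDim_eq_of_hasCodimension hcodim
  have hE := PureHilbert.isHilbertCoefficients_bettiMoment hgraded hd0 hpure hs hdim
  refine ⟨hs, ⟨_, hE⟩, fun e he => ?_⟩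
  have hformula : ∀ i ≤ n - s, (e i : ℚ) =
      (β 0 : ℚ) * (((∏ j ∈ Finset.Icc 1 s, d j : ℤ) : ℚ) / ((s + i).factorial : ℚ)) *
        (PureHilbert.shiftedSum s d i : ℚ) := by
    intro i hi
    have h := PureHilbert.factorial_mul_sum_choose_eq_shiftedSum
      (w := fun j => (-1) ^ j * (β j : ℤ)) hd0
      (fun k hk => PureHilbert.bettiMoment_eq_zero hgraded hd0 hpure hs hdim hk) i
    -- The Hilbert polynomial determines its coefficients, so an arbitrary `e` may be replaced by
    -- the moments.
    rw [he.unique hE hi]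
    rw [← PureHilbert.bettiMoment] at h
    have hsq : ((-1 : ℚ) ^ s) * (-1) ^ s = 1 := by rw [← mul_pow]; simp
    have hq := congrArg (Int.cast : ℤ → ℚ) h
    push_cast at hq ⊢
    have hfac : ((s + i).factorial : ℚ) ≠ 0 := by positivity
    field_simp
    linear_combination (-1 : ℚ) ^ s * hq + (β 0 : ℚ) * (∏ j ∈ Finset.Icc 1 s, (d j : ℚ)) *
      (PureHilbert.shiftedSum s d i : ℚ) * hsq
  refine ⟨hformula, ?_, fun h1 => ?_, fun h2 => ?_⟩
  · rw [hformula 0 (Nat.zero_le _), PureHilbert.shiftedSum_zero_right]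
    simp
  · rw [hformula 1 h1, PureHilbert.shiftedSum_one]
  · rw [hformula 2 h2, PureHilbert.shiftedSum_two]
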